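/- Let $p\ge 5$. The white metallic tree with the rightmost assignment, $\mathcal W_\rho$, is the infinite ordered tree with white root in which every white node has $p-2$ sons, every black node has $p-3$ sons, and the black nodes are exactly the rightmost sons of the nodes. (An assignment on a tree with white root gives each node $\nu$ a status, $0$ for white and $1$ for black, its leftmost son, and the position of its unique black son among its $p-2-\mathrm{status}(\nu)$ sons; it is the rightmost assignment if the black son is always the last one.) Nodes are identified with their numbers in the natural numbering: the root is $1$, and one numbers level by level, from left to right on each level. Let $m_k$ be the number of nodes on level $k$ of the white metallic tree. The nzm-code $[n]_{nz}$ of $n\ge1$ is the unique word $a_k\cdots a_0$ with digits in $\{1,\dots,p-2\}$, $n=\sum_{i=0}^k a_i m_i$, and no factor $x\,d^h\,x$ ($h\ge 0$), where $x=p-2$ and $d=p-3$; write $(w)$ for the number represented by a word $w$. A $1$-node is a node whose nzm-code ends in the digit $1$. Theorem. Every $n\geq 1$ has exactly one nzm-code, and $\rho$ is a rightmost assignment on $\mathcal W_\rho$. Let $\mathcal V$ be the set of $1$-nodes of $\mathcal W_\rho$ other than the root $1$. For each $\nu\ge1$ the word $[\nu]_{nz}1$ is the nzm-code of a node in $\mathcal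 V$, and the rule $\varphi\bigl(([\nu]_{nz}1)\bigr)=\nu$ defines a map $\varphi$ from $\mathcal V$ onto $\mathcal W_\rho$. Take $([1]_{nz}1)$ as the root of $\mathcal V$, and define the sons of $([\nu]_{nz}1)$, in increasing order, to be the $1$-nodes among the $\rho$-sons of the $\rho$-sons of $\nu$. Then $\mathcal V$ is an infinite ordered tree, and $\varphi$ is an isomorphism of numbered trees from $\mathcal V$, with its own natural numbering, onto $\mathcal W_\rho$: it is a bijection which preserves the natural numbers of the nodes (so the number of $v$ in $\mathcal V$ is $\varphi(v)$), the levels and the number of sons, and it sends the root to the root and the sons of a node, in order, to the sons of its image. Moreover $\varphi^{-1}$ transports the $\rho$-assignment onto $\mathcal V$: giving $v\in\mathcal V$ the status of $\varphi(v)$, the position of the black son of $\varphi(v)$, and as leftmost son the image under $\varphi^{-1}$ of the leftmost $\rho$-son of $\varphi(v)$, one obtains an assignment on the tree $\mathcal V$, and it is the rightmost assignment. -/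

import Mathlib

/-!
Metallic trees, their assignments, and non-zero metallic codes.
-/

namespace Metallic

/-! ### Ordered trees and natural numbering -/

/-- Data of a finitely branching ordered tree: nodes, root, and the list of the sons of each node,
from left to right (only the values of `sons` at nodes matter). -/
structure OrderedTree (α : Type*) where
  nodes : Set α
  root : α
  sons : α → List α

namespace OrderedTree

variable {α : Type*} {β : Type*}

/-- The nodes of level `k`, from left to right. -/
def level (T : OrderedTree α) : ℕ → List α
  | 0 => [T.root]
  | k + 1 => (T.level k).flatMap T.sons

/-- The data really form an infinite rooted tree with the given set of nodes: the descendants of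
the root are nodes, every node is reached exactly once, and no level is empty. -/
structure IsInfiniteTree (T : OrderedTree α) : Prop where
  level_subset : ∀ k, ∀ a ∈ T.level k, a ∈ T.nodes
  existsUnique_place : ∀ a ∈ T.nodes, ∃! ki : ℕ × ℕ, (T.level ki.1)[ki.2]? = some a
  level_ne_nil : ∀ k, T.level k ≠ []

/-- `a` receives the number `n` in the natural numbering of `T`: the root receives `1`, and the
nodes are numbered level by level and, on each level, from left to right. -/
def HasNumber (T : OrderedTree α) (a : α) (n : ℕ) : Prop :=
  ∃ k i, (T.level k)[i]? = some a ∧ n = (∑ j ∈ Finset.range k, (T.level j).length) + i + 1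

/-- `f` is an isomorphism of infinite numbered trees: a bijection between the nodes which preserves
the numbers of the natural numberings, the levels and the number of sons; moreover it sends the
root to the root and the sons of a node, in order, to the sons of its image. -/
structure IsNumberedIso (S : OrderedTree α) (T : OrderedTree β) (f : α → β) : Prop where
  source : S.IsInfiniteTree
  target : T.IsInfiniteTree
  bijOn : Set.BijOn f S.nodes T.nodes
  number_iff : ∀ a ∈ S.nodes, ∀ n, S.HasNumber a n ↔ T.HasNumber (f a) n
  level_iff : ∀ a ∈ S.nodes, ∀ k, a ∈ S.level k ↔ f a ∈ T.level k
  length_sons : ∀ a ∈ S.nodes, (T.sons (f a)).length = (S.sons a).length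
  map_root : f S.root = T.root
  map_sons : ∀ a ∈ S.nodes, T.sons (f a) = (S.sons a).map f

end OrderedTree

/-! ### Assignments -/

/-- The data of an assignment: the leftmost son of each node, the position of the black son among
the sons of the node (the leftmost position being `1`), and the numerical status of the node
(`0` for white, `1` for black). -/
structure Assignment (α : Type*) where
  leftmost : α → α
  blackPos : α → ℕ
  status : α → ℕ

variable {α : Type*} {β : Type*}

/-- `A` is an assignment on `T`, for a white root: white nodes have `p - 2` sons, black nodes have
`p - 3` sons, and exactly one son of each node is black, namely the one at the given position. -/
structure IsAssignment (p : ℕ) (T : OrderedTree α) (A : Assignment α) : Prop where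
  status_root : A.status T.root = 0
  status_eq : ∀ a ∈ T.nodes, A.status a = 0 ∨ A.status a = 1
  length_sons : ∀ a ∈ T.nodes, (T.sons a).length = p - 2 - A.status a
  head_sons : ∀ a ∈ T.nodes, (T.sons a).head? = some (A.leftmost a)
  blackPos_mem : ∀ a ∈ T.nodes, 1 ≤ A.blackPos a ∧ A.blackPos a ≤ p - 2 - A.status a
  status_sons : ∀ a ∈ T.nodes, ∀ i b, (T.sons a)[i]? = some b →
    (A.status b = 1 ↔ i + 1 = A.blackPos a)

/-- `A` is the rightmost assignment on `T`: the black son is always the last one. -/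
structure IsRightmostAssignment (p : ℕ) (T : OrderedTree α) (A : Assignment α) : Prop where
  isAssignment : IsAssignment p T A
  blackPos_eq : ∀ a ∈ T.nodes, A.blackPos a = p - 2 - A.status a

/-- The assignment transported by the inverse of `f : D → β` to the nodes in `D`. -/
noncomputable def Assignment.transport [Nonempty α] (A : Assignment β) (f : α → β) (D : Set α) :
    Assignment α where
  leftmost a := Function.invFunOn f D (A.leftmost (f a))
  blackPos a := A.blackPos (f a)
  status a := A.status (f a)

/-! ### The white metallic tree -/

/-- The statuses of the sons of a node of status `s`, from left to right, when the black son of a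
node of status `s` is at position `pos s`. -/
def rule (p : ℕ) (pos : ℕ → ℕ) (s : ℕ) : List ℕ :=
  (List.range' 1 (p - 2 - s)).map fun i => if i = pos s then 1 else 0

/-- The statuses of the nodes of level `k`, from left to right, when the rules are applied starting
from a white root. -/
def levelStatus (p : ℕ) (pos : ℕ → ℕ) : ℕ → List ℕ
  | 0 => [0]
  | k + 1 => (levelStatus p pos k).flatMap (rule p pos)

/-- The metallic number `m_k`: the number of nodes of level `k` of the white metallic tree, given by
the rules `b → b w ^ (p - 4)`, `w → b w ^ (p - 3)`. -/
def metallic (p k : ℕ) : ℕ := (levelStatus p (fun _ => 1) k).length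

/-- The position of the black son in the rightmost assignment. -/
def rhoPos (p s : ℕ) : ℕ := p - 2 - s

/-- The status of the node numbered `n` under the rightmost assignment: its entry in the
concatenation of the levels `0, ..., n - 1`, which contain at least `n` nodes. -/
def rhoStatus (p n : ℕ) : ℕ :=
  ((List.range n).flatMap (levelStatus p (rhoPos p))).getD (n - 1) 0

/-- The number of the leftmost son of `n` under the rightmost assignment: it comes after the root
and all the sons of the nodes `1, ..., n - 1`. -/
def rhoLeft (p n : ℕ) : ℕ := 2 + ∑ j ∈ Finset.Ico 1 n, (p - 2 - rhoStatus p j)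

/-- The rightmost assignment on the white metallic tree. -/
def rho (p : ℕ) : Assignment ℕ where
  leftmost := rhoLeft p
  blackPos n := rhoPos p (rhoStatus p n)
  status := rhoStatus p

/-- The white metallic tree equipped with the rightmost assignment; its nodes are identified with
their numbers. -/
def whiteTree (p : ℕ) : OrderedTree ℕ where
  nodes := {n | 1 ≤ n}
  root := 1
  sons n := List.range' (rhoLeft p n) (p - 2 - rhoStatus p n)

/-! ### Non-zero metallic codes -/

/-- The number represented by a word of digits, the leftmost digit being the leading one:
`a_k ... a_0` represents the sum of the `a_i * m_i`. -/
def value (p : ℕ) : List ℕ → ℕ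
  | [] => 0
  | a :: w => a * metallic p w.length + value p w

/-- `w` is a non-zero metallic code of `n`: its digits lie in `{1, ..., p - 2}`, it represents `n`,
and it has no factor `x d^h x`, where `x = p - 2` and `d = p - 3`. -/
structure IsNzmCode (p : ℕ) (w : List ℕ) (n : ℕ) : Prop where
  digit_mem : ∀ a ∈ w, 1 ≤ a ∧ a ≤ p - 2
  not_forbidden : ∀ h : ℕ, ¬ ((p - 2) :: (List.replicate h (p - 3) ++ [p - 2])) <:+: w
  value_eq : value p w = n

/-- The non-zero metallic code of `n`. -/
noncomputable def nzmCode (p n : ℕ) : List ℕ := Classical.epsilon fun w => IsNzmCode p w n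

/-- The nodes whose non-zero metallic code ends in the digit `1`. -/
def IsOneNode (p n : ℕ) : Prop := (nzmCode p n).getLast? = some 1

/-- The successor of `n`: the node whose code is obtained by appending `1` to the code of `n`. -/
noncomputable def succ (p n : ℕ) : ℕ := value p (nzmCode p n ++ [1])

/-- The mapping which erases the last digit of the code of a node. -/
noncomputable def phi (p v : ℕ) : ℕ := value p (nzmCode p v).dropLast

open Classical in
/-- The tree of the `1`-nodes, the node `1` being excepted: its root is the successor of `1`, and
the sons of a node `v` are the sons which are `1`-nodes of the sons of `phi p v`. -/
noncomputable def oneTree (p : ℕ) : OrderedTree ℕ where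
  nodes := {v | 2 ≤ v ∧ IsOneNode p v}
  root := succ p 1
  sons v := (((whiteTree p).sons (phi p v)).flatMap (whiteTree p).sons).filter
    fun u => decide (IsOneNode p u)

end Metallic

/-! Write `S n` for `sonsUpTo p n`. Level by level numbering makes the sons of `n + 1` exactly the
numbers `S n + 2, ..., S (n + 1) + 1`, the last of them being black. Among the nodes `1, ..., S n +
1`, that is, the root and the sons of `1, ..., n`, exactly `n` are black, so `S (S n + 1) + n = (p -
2) * (S n + 1)`. This mirrors the recurrence `m_(k+2) + m_k = (p - 2) * m_(k+1)`.

By induction on words (`IsNzmWord.shift`), if an admissible `w` has value `n`, then `w0` has value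
`S n`, and `w` ends in `x d^h` exactly when the node `n + 1` is black. Hence `wa` has value `S n +
a`, and the admissible digits `a` are `1, ..., sonCount p (n + 1)`. Since the intervals `(S n, S (n
+ 1)]` partition the positive integers, codes exist and are unique.

In particular `[n]1` represents `S n + 1`, the last son of `n`. So every node has exactly one
`1`-node among its sons, `succ p n`, and the `1`-nodes two generations below `n` are the successors
of the sons of `n`. Thus `succ` carries the whole tree structure over, and `phi` inverts it. -/

namespace Metallic

/-! ### The sequence of statuses -/

/-- The number of sons of the node `n` under the rightmost assignment. -/
def sonCount (p n : ℕ) : ℕ := p - 2 - rhoStatus p n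

/-- The total number of sons of the nodes `1, ..., n` under the rightmost assignment. -/
def sonsUpTo (p n : ℕ) : ℕ := ∑ j ∈ Finset.range n, sonCount p (j + 1)

theorem sonsUpTo_zero (p : ℕ) : sonsUpTo p 0 = 0 := rfl

theorem sonsUpTo_succ (p n : ℕ) : sonsUpTo p (n + 1) = sonsUpTo p n + sonCount p (n + 1) :=
  Finset.sum_range_succ _ _

theorem rhoLeft_succ (p n : ℕ) : rhoLeft p (n + 1) = sonsUpTo p n + 2 := by
  simp only [rhoLeft, sonsUpTo, sonCount, Finset.sum_Ico_eq_sum_range, Nat.add_sub_cancel]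
  rw [add_comm]
  simp only [add_comm 1]

theorem rule_getElem? (p s i : ℕ) (hi : i < p - 2 - s) :
    (rule p (rhoPos p) s)[i]? = some (if i + 1 = p - 2 - s then 1 else 0) := by
  simp [rule, rhoPos, hi, add_comm]

theorem length_rule (p : ℕ) (pos : ℕ → ℕ) (s : ℕ) : (rule p pos s).length = p - 2 - s := by
  simp [rule]

theorem le_one_of_mem_rule {p : ℕ} {pos : ℕ → ℕ} {s a : ℕ} (h : a ∈ rule p pos s) : a ≤ 1 := by
  simp only [rule, List.mem_map] at h
  obtain ⟨i, -, rfl⟩ := h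
  split_ifs <;> simp

theorem le_one_of_mem_levelStatus {p : ℕ} {pos : ℕ → ℕ} {k a : ℕ}
    (h : a ∈ levelStatus p pos k) : a ≤ 1 := by
  cases k with
  | zero => simp_all [levelStatus]
  | succ k =>
    simp only [levelStatus, List.mem_flatMap] at h
    obtain ⟨s, -, hs⟩ := h
    exact le_one_of_mem_rule hs

theorem levelStatus_ne_nil {p : ℕ} (hp : 5 ≤ p) (pos : ℕ → ℕ) (k : ℕ) :
    levelStatus p pos k ≠ [] := by
  induction k with
  | zero => simp [levelStatus]
  | succ k ih =>
    obtain ⟨s, hs⟩ := List.exists_mem_of_ne_nil _ ih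
    have h1 := le_one_of_mem_levelStatus hs
    intro h
    have h2 := List.flatMap_eq_nil_iff.1 h s hs
    have h3 := length_rule p pos s
    rw [h2, List.length_nil] at h3
    omega

/-- The concatenation of the statuses of the nodes of the levels `0, ..., N - 1`. -/
def statusPrefix (p N : ℕ) : List ℕ := (List.range N).flatMap (levelStatus p (rhoPos p))

theorem statusPrefix_succ (p N : ℕ) :
    statusPrefix p (N + 1) = statusPrefix p N ++ levelStatus p (rhoPos p) N := by
  simp [statusPrefix, List.range_succ]

/-- The status sequence is fixed by the substitution once the root is put in front; this form no
longer refers to levels. -/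
theorem statusPrefix_succ_eq_cons (p N : ℕ) :
    statusPrefix p (N + 1) = 0 :: (statusPrefix p N).flatMap (rule p (rhoPos p)) := by
  induction N with
  | zero => simp [statusPrefix, levelStatus]
  | succ N ih =>
    rw [statusPrefix_succ p (N + 1)]
    nth_rw 1 [ih]
    rw [statusPrefix_succ p N, List.flatMap_append, levelStatus, List.cons_append]

theorem le_length_statusPrefix {p : ℕ} (hp : 5 ≤ p) (N : ℕ) : N ≤ (statusPrefix p N).length := by
  induction N with
  | zero => simp
  | succ N ih =>
    have := List.length_pos_iff.2 (levelStatus_ne_nil hp (rhoPos p) N)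
    rw [statusPrefix_succ, List.length_append]
    omega

theorem statusPrefix_prefix (p : ℕ) {M N : ℕ} (h : M ≤ N) :
    statusPrefix p M <+: statusPrefix p N := by
  induction h with
  | refl => exact List.prefix_rfl
  | step _ ih => exact ih.trans (by rw [statusPrefix_succ]; exact List.prefix_append _ _)

/-- `rhoStatus` reads a prefix whose length depends on the node; as the prefixes extend one another,
any long enough one gives the same entry. -/
theorem statusPrefix_getElem? {p : ℕ} (hp : 5 ≤ p) {N j : ℕ}
    (hj : j < (statusPrefix p N).length) :
    (statusPrefix p N)[j]? = some (rhoStatus p (j + 1)) := by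
  have hj' : j < (statusPrefix p (j + 1)).length := le_length_statusPrefix hp (j + 1)
  have h : (statusPrefix p (j + 1))[j]? = some (rhoStatus p (j + 1)) := by
    change _ = some ((statusPrefix p (j + 1)).getD j 0)
    rw [List.getD_eq_getElem?_getD, List.getElem?_eq_getElem hj', Option.getD_some]
  rw [← h]
  rcases le_total N (j + 1) with hN | hN
  · obtain ⟨t, ht⟩ := statusPrefix_prefix p hN
    rw [← ht, List.getElem?_append_left hj]
  · obtain ⟨t, ht⟩ := statusPrefix_prefix p hN
    rw [← ht, List.getElem?_append_left hj']

theorem statusPrefix_eq_map {p : ℕ} (hp : 5 ≤ p) (N : ℕ) :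
    statusPrefix p N =
      (List.range (statusPrefix p N).length).map fun j => rhoStatus p (j + 1) := by
  apply List.ext_getElem?
  intro j
  by_cases hj : j < (statusPrefix p N).length
  · rw [statusPrefix_getElem? hp hj]
    simp [hj]
  · simp [hj]

theorem rhoStatus_le_one {p : ℕ} (hp : 5 ≤ p) (n : ℕ) : rhoStatus p (n + 1) ≤ 1 := by
  have h := statusPrefix_getElem? hp (le_length_statusPrefix hp (n + 1))
  have h' := List.mem_of_getElem? h
  simp only [statusPrefix, List.mem_flatMap] at h'
  obtain ⟨k, -, hk⟩ := h'
  exact le_one_of_mem_levelStatus hk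

theorem rhoStatus_one (p : ℕ) : rhoStatus p 1 = 0 := by
  simp [rhoStatus, levelStatus]

theorem length_flatMap_range (f : ℕ → List ℕ) (L : ℕ) :
    ((List.range L).flatMap f).length = ∑ j ∈ Finset.range L, (f j).length := by
  induction L with
  | zero => simp
  | succ L ih => simp [List.range_succ, Finset.sum_range_succ, ih]

theorem flatMap_range_getElem? (f : ℕ → List ℕ) {L n i : ℕ} (hn : n < L)
    (hi : i < (f n).length) :
    ((List.range L).flatMap f)[(∑ j ∈ Finset.range n, (f j).length) + i]? = (f n)[i]? := by
  induction L with
  | zero => omega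
  | succ L ih =>
    rw [List.range_succ, List.flatMap_append]
    rcases Nat.lt_succ_iff_lt_or_eq.1 hn with h | rfl
    · rw [List.getElem?_append_left, ih h]
      rw [length_flatMap_range]
      calc _ < ∑ j ∈ Finset.range (n + 1), (f j).length := by
            rw [Finset.sum_range_succ]; omega
        _ ≤ _ := Finset.sum_le_sum_of_subset (by simpa using h)
    · rw [List.getElem?_append_right (by rw [length_flatMap_range]; omega),
        length_flatMap_range]
      simp

/-- The statuses of the sons of the node `n + 1`. -/
theorem rhoStatus_son {p : ℕ} (hp : 5 ≤ p) {n i : ℕ} (hi : i < sonCount p (n + 1)) :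
    rhoStatus p (sonsUpTo p n + i + 2) = if i + 1 = sonCount p (n + 1) then 1 else 0 := by
  have hn : n < (statusPrefix p (n + 1)).length := le_length_statusPrefix hp (n + 1)
  have key : (statusPrefix p (n + 2))[sonsUpTo p n + i + 1]? =
      some (if i + 1 = sonCount p (n + 1) then 1 else 0) := by
    rw [statusPrefix_succ_eq_cons, List.getElem?_cons_succ, statusPrefix_eq_map hp,
      List.flatMap_map]
    have h := flatMap_range_getElem? (fun j => rule p (rhoPos p) (rhoStatus p (j + 1))) hn
      (i := i) (by rw [length_rule]; exact hi)
    simp only [length_rule] at h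
    rw [rule_getElem? _ _ _ hi] at h
    exact h
  have h2 := statusPrefix_getElem? hp (List.getElem?_eq_some_iff.1 key).1
  rw [key] at h2
  exact (Option.some.inj h2).symm

theorem sonCount_eq {p : ℕ} (hp : 5 ≤ p) (n : ℕ) :
    rhoStatus p (n + 1) = 0 ∧ sonCount p (n + 1) = p - 2 ∨
      rhoStatus p (n + 1) = 1 ∧ sonCount p (n + 1) = p - 3 := by
  have := rhoStatus_le_one hp n
  unfold sonCount
  omega

theorem two_le_sonCount {p : ℕ} (hp : 5 ≤ p) (n : ℕ) : 2 ≤ sonCount p (n + 1) := by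
  have := sonCount_eq hp n
  omega

theorem sonsUpTo_strictMono {p : ℕ} (hp : 5 ≤ p) : StrictMono (sonsUpTo p) :=
  strictMono_nat_of_lt_succ fun n => by
    have := two_le_sonCount hp n
    rw [sonsUpTo_succ]
    omega

/-- The `a` nodes added are sons of `n + 1` other than the last, hence white. -/
theorem sonsUpTo_add_of_lt {p : ℕ} (hp : 5 ≤ p) {n a : ℕ} (ha : a < sonCount p (n + 1)) :
    sonsUpTo p (sonsUpTo p n + 1 + a) = sonsUpTo p (sonsUpTo p n + 1) + (p - 2) * a := by
  induction a with
  | zero => simp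
  | succ a ih =>
    have h := rhoStatus_son hp (n := n) (i := a) (by omega)
    rw [if_neg (by omega)] at h
    have h' : sonCount p (sonsUpTo p n + 1 + a + 1) = p - 2 := by
      rw [sonCount, show sonsUpTo p n + 1 + a + 1 = sonsUpTo p n + a + 2 by ring, h, Nat.sub_zero]
    rw [← add_assoc, sonsUpTo_succ, ih (by omega), h']
    ring

/-- Each of the nodes `1, ..., n` has one black son, which costs one son in the next generation. -/
theorem sonsUpTo_sonsUpTo {p : ℕ} (hp : 5 ≤ p) (n : ℕ) :
    sonsUpTo p (sonsUpTo p n + 1) + n = (p - 2) * (sonsUpTo p n + 1) := by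
  induction n with
  | zero => simp [sonsUpTo_zero, sonsUpTo_succ, sonCount, rhoStatus_one]
  | succ n ih =>
    obtain ⟨c, hc⟩ : ∃ c, sonCount p (n + 1) = c + 1 :=
      ⟨sonCount p (n + 1) - 1, by have := two_le_sonCount hp n; omega⟩
    have h1 := sonsUpTo_add_of_lt hp (n := n) (a := c) (by omega)
    have h := rhoStatus_son hp (n := n) (i := c) (by omega)
    rw [if_pos hc.symm] at h
    have h' : sonCount p (sonsUpTo p n + 1 + c + 1) = p - 3 := by
      rw [sonCount, show sonsUpTo p n + 1 + c + 1 = sonsUpTo p n + c + 2 by ring, h]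
      omega
    rw [sonsUpTo_succ p n, hc, show sonsUpTo p n + (c + 1) + 1 = (sonsUpTo p n + 1 + c) + 1 by ring,
      sonsUpTo_succ, h1, h']
    obtain ⟨q, rfl⟩ : ∃ q, p = q + 3 := ⟨p - 3, by omega⟩
    simp only [Nat.add_sub_cancel, show q + 3 - 2 = q + 1 by omega] at *
    linarith

/-- Every `n ≥ 1` is the rank, among all the nodes but the root, of the `a`-th son of a node `m + 1`. -/
theorem exists_sonsUpTo_add {p : ℕ} (hp : 5 ≤ p) {n : ℕ} (hn : 1 ≤ n) :
    ∃ m a, 1 ≤ a ∧ a ≤ sonCount p (m + 1) ∧ n = sonsUpTo p m + a := by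
  induction n, hn using Nat.le_induction with
  | base => exact ⟨0, 1, le_rfl, by have := two_le_sonCount hp 0; omega, rfl⟩
  | succ n _ ih =>
    obtain ⟨m, a, h1, h2, rfl⟩ := ih
    rcases h2.lt_or_eq with h | h
    · exact ⟨m, a + 1, by omega, h, rfl⟩
    · refine ⟨m + 1, 1, le_rfl, by have := two_le_sonCount hp (m + 1); omega, ?_⟩
      rw [sonsUpTo_succ, h]

theorem sonsUpTo_add_inj {p : ℕ} (hp : 5 ≤ p) {m m' a a' : ℕ} (h1 : 1 ≤ a)
    (h2 : a ≤ sonCount p (m + 1)) (h1' : 1 ≤ a') (h2' : a' ≤ sonCount p (m' + 1))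
    (h : sonsUpTo p m + a = sonsUpTo p m' + a') : m = m' ∧ a = a' := by
  have hm := (sonsUpTo_strictMono hp).monotone
  have e := sonsUpTo_succ p m
  have e' := sonsUpTo_succ p m'
  rcases lt_trichotomy m m' with hlt | rfl | hlt
  · have := hm (show m + 1 ≤ m' from hlt)
    omega
  · omega
  · have := hm (show m' + 1 ≤ m from hlt)
    omega

/-! ### Metallic numbers and values of words -/

theorem sum_rule_one {p s : ℕ} (hs : s < p - 2) : (rule p (fun _ => 1) s).sum = 1 := by
  obtain ⟨c, hc⟩ : ∃ c, p - 2 - s = c + 1 := ⟨p - 2 - s - 1, by omega⟩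
  rw [rule, hc, List.range'_succ, List.map_cons, List.sum_cons, if_pos rfl, List.sum_eq_zero, add_zero]
  intro x hx
  simp only [List.mem_map, List.mem_range'_1] at hx
  obtain ⟨i, hi, rfl⟩ := hx
  rw [if_neg (by omega)]

theorem flatMap_rule_one {p : ℕ} {l : List ℕ} (hl : ∀ s ∈ l, s < p - 2) :
    (l.flatMap (rule p fun _ => 1)).sum = l.length ∧
      (l.flatMap (rule p fun _ => 1)).length + l.sum = (p - 2) * l.length := by
  induction l with
  | nil => simp
  | cons s l ih =>
    obtain ⟨h1, h2⟩ := ih fun t ht => hl t (List.mem_cons_of_mem _ ht)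
    have hs := hl s List.mem_cons_self
    simp only [List.flatMap_cons, List.sum_append, List.length_append, List.length_cons,
      List.sum_cons, sum_rule_one hs, length_rule, h1, mul_add, ← h2]
    omega

theorem metallic_zero (p : ℕ) : metallic p 0 = 1 := rfl

theorem metallic_one (p : ℕ) : metallic p 1 = p - 2 := by
  simp [metallic, levelStatus, length_rule]

/-- The black nodes of level `k + 1` are as many as the nodes of level `k`, and each lacks one son.
-/
theorem metallic_add_two {p : ℕ} (hp : 5 ≤ p) (k : ℕ) :
    metallic p (k + 2) + metallic p k = (p - 2) * metallic p (k + 1) := by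
  have h (j : ℕ) := flatMap_rule_one (p := p) (l := levelStatus p (fun _ => 1) j) fun s hs => by
    have := le_one_of_mem_levelStatus hs
    omega
  have h1 := (h k).1
  have h2 := (h (k + 1)).2
  change (levelStatus p (fun _ => 1) (k + 1)).sum = _ at h1
  rw [h1] at h2
  exact h2

theorem value_append_singleton (p : ℕ) (w : List ℕ) (a : ℕ) :
    value p (w ++ [a]) = value p (w ++ [0]) + a := by
  induction w with
  | nil => simp [value, metallic_zero]
  | cons b w ih => simp [value, ih, add_assoc]

/-- The recurrence of the metallic numbers, applied digit by digit. The digit `0`, not allowed in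
codes, serves only to shift the weights. -/
theorem value_append_pair {p : ℕ} (hp : 5 ≤ p) (w : List ℕ) (a : ℕ) :
    value p (w ++ [a] ++ [0]) + value p w = (p - 2) * (value p (w ++ [0]) + a) := by
  induction w with
  | nil => simp [value, metallic_one, mul_comm]
  | cons b w ih =>
    have h := metallic_add_two hp w.length
    simp only [value, List.cons_append, List.length_append, List.length_singleton] at ih ⊢
    linear_combination ih + b * h

/-! ### Existence and uniqueness of the codes -/

/-- The word `w` ends in `x d ^ h` for some `h`, where `x = p - 2` and `d = p - 3`. -/
def Ending (p : ℕ) (w : List ℕ) : Prop := ∃ h : ℕ, ((p - 2) :: List.replicate h (p - 3)) <:+ w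

theorem append_singleton_suffix_iff {u w : List ℕ} {a b : ℕ} :
    u ++ [b] <:+ w ++ [a] ↔ b = a ∧ u <:+ w := by
  rw [← List.reverse_prefix, ← List.reverse_prefix]
  simp [List.cons_prefix_cons]

theorem not_ending_nil (p : ℕ) : ¬ Ending p [] := by
  simp [Ending]

/-- A two-state automaton recognizes these endings; its state will be the status of a node. -/
theorem ending_append_singleton (p : ℕ) (w : List ℕ) (a : ℕ) :
    Ending p (w ++ [a]) ↔ a = p - 2 ∨ a = p - 3 ∧ Ending p w := by
  constructor
  · rintro ⟨_ | h, hh⟩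
    · have := (append_singleton_suffix_iff (u := []) (b := p - 2)).1 hh
      exact Or.inl this.1.symm
    · rw [List.replicate_succ', ← List.cons_append, append_singleton_suffix_iff] at hh
      exact Or.inr ⟨hh.1.symm, h, hh.2⟩
  · rintro (rfl | ⟨rfl, h, hh⟩)
    · exact ⟨0, by simp⟩
    · exact ⟨h + 1, by
        rw [List.replicate_succ', ← List.cons_append, append_singleton_suffix_iff]
        exact ⟨rfl, hh⟩⟩

/-- `w` satisfies the conditions on the words used as codes. -/
def IsNzmWord (p : ℕ) (w : List ℕ) : Prop := IsNzmCode p w (value p w)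

theorem isNzmWord_nil (p : ℕ) : IsNzmWord p [] :=
  ⟨by simp, by simp, rfl⟩

/-- A forbidden factor created by the new digit must be a suffix, so its final `x` is that digit. -/
theorem isNzmWord_append_singleton (p : ℕ) (w : List ℕ) (a : ℕ) :
    IsNzmWord p (w ++ [a]) ↔
      IsNzmWord p w ∧ 1 ≤ a ∧ a ≤ p - 2 ∧ (a = p - 2 → ¬ Ending p w) := by
  constructor
  · rintro ⟨h1, h2, -⟩
    refine ⟨⟨fun b hb => h1 b (by simp [hb]), fun h hh => h2 h ?_, rfl⟩, (h1 a (by simp)).1,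
      (h1 a (by simp)).2, ?_⟩
    · exact List.infix_concat_iff.2 (Or.inr hh)
    · rintro rfl ⟨h, hh⟩
      refine h2 h (List.infix_concat_iff.2 (Or.inl ?_))
      rw [← List.cons_append, append_singleton_suffix_iff]
      exact ⟨rfl, hh⟩
  · rintro ⟨⟨h1, h2, -⟩, h3, h4, h5⟩
    refine ⟨fun b hb => ?_, fun h hh => ?_, rfl⟩
    · rcases List.mem_append.1 hb with hb | hb
      · exact h1 b hb
      · rw [List.mem_singleton.1 hb]
        exact ⟨h3, h4⟩
    · rcases List.infix_concat_iff.1 hh with hh | hh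
      · rw [← List.cons_append, append_singleton_suffix_iff] at hh
        exact h5 hh.1.symm ⟨h, hh.2⟩
      · exact h2 h hh

/-- Appending `0` to a word of value `n` yields the number of sons of the nodes `1, ..., n`, and
the ending of the word determines the status of the node `n + 1`. -/
theorem IsNzmWord.shift {p : ℕ} (hp : 5 ≤ p) {w : List ℕ} (hw : IsNzmWord p w) :
    value p (w ++ [0]) = sonsUpTo p (value p w) ∧
      (rhoStatus p (value p w + 1) = 1 ↔ Ending p w) := by
  induction w using List.reverseRecOn with
  | nil => simp [value, sonsUpTo_zero, rhoStatus_one, not_ending_nil]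
  | append_singleton w a ih =>
    obtain ⟨h1, h2, h3, h4⟩ := (isNzmWord_append_singleton p w a).1 hw
    obtain ⟨i1, i2⟩ := ih h1
    obtain ⟨b, rfl⟩ : ∃ b, a = b + 1 := ⟨a - 1, by omega⟩
    have hc := sonCount_eq hp (value p w)
    have hb : b < sonCount p (value p w + 1) := by
      -- If the node is black, `w` ends in `x d^h`, which excludes the digit `p - 2`.
      rcases hc with ⟨_, hc⟩ | ⟨hc', hc⟩
      · omega
      · have : b + 1 ≠ p - 2 := fun h => h4 h (i2.1 hc')
        omega
    have hs := rhoStatus_son hp hb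
    have hv : value p (w ++ [b + 1]) = sonsUpTo p (value p w) + 1 + b := by
      rw [value_append_singleton, i1]; ring
    constructor
    · have e1 := value_append_pair hp w (b + 1)
      have e2 := sonsUpTo_add_of_lt hp hb
      have e3 := sonsUpTo_sonsUpTo hp (value p w)
      rw [hv, e2]
      rw [i1] at e1
      linarith
    -- The next node is the son of `value p w + 1` at position `b + 1`: it is black when this digit
    -- is maximal, namely `p - 2` under a white father and `p - 3` under a black one.
    · rw [hv, show sonsUpTo p (value p w) + 1 + b + 1 = sonsUpTo p (value p w) + b + 2 by ring, hs,
        ending_append_singleton, ← i2]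
      rcases hc with ⟨hc', hc⟩ | ⟨hc', hc⟩ <;> rw [hc, hc'] <;> split_ifs <;> simp <;> omega

theorem isNzmWord_append_singleton_iff_le_sonCount {p : ℕ} (hp : 5 ≤ p) (w : List ℕ) (a : ℕ) :
    IsNzmWord p (w ++ [a]) ↔
      IsNzmWord p w ∧ 1 ≤ a ∧ a ≤ sonCount p (value p w + 1) := by
  rw [isNzmWord_append_singleton]
  refine and_congr_right fun hw => and_congr_right fun _ => ?_
  rw [← (hw.shift hp).2]
  have := sonCount_eq hp (value p w)
  omega

theorem IsNzmWord.value_append {p : ℕ} (hp : 5 ≤ p) {w : List ℕ} (hw : IsNzmWord p w) (a : ℕ) :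
    value p (w ++ [a]) = sonsUpTo p (value p w) + a := by
  rw [value_append_singleton, (hw.shift hp).1]

theorem exists_isNzmCode {p : ℕ} (hp : 5 ≤ p) (n : ℕ) : ∃ w, IsNzmCode p w n := by
  induction n using Nat.strong_induction_on with
  | _ n ih =>
    rcases Nat.eq_zero_or_pos n with rfl | hn
    · exact ⟨[], isNzmWord_nil p⟩
    · obtain ⟨m, a, h1, h2, rfl⟩ := exists_sonsUpTo_add hp hn
      -- Here `m < n` because `m ≤ S m` and `1 ≤ a`.
      obtain ⟨w, hw⟩ := ih m (by have := (sonsUpTo_strictMono hp).le_apply (x := m); omega)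
      obtain rfl := hw.value_eq
      refine ⟨w ++ [a], ?_⟩
      rw [← IsNzmWord.value_append hp hw]
      exact (isNzmWord_append_singleton_iff_le_sonCount hp w a).2 ⟨hw, h1, h2⟩

/-- The interval `(S m, S (m + 1)]` containing the value determines both the last digit and the
value `m` of the remaining word. -/
theorem IsNzmWord.value_inj {p : ℕ} (hp : 5 ≤ p) {w w' : List ℕ} (hw : IsNzmWord p w)
    (hw' : IsNzmWord p w') (h : value p w = value p w') : w = w' := by
  induction w using List.reverseRecOn generalizing w' with
  | nil =>
    rcases List.eq_nil_or_concat w' with rfl | ⟨v, b, rfl⟩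
    · rfl
    · rw [List.concat_eq_append] at *
      obtain ⟨hv, h1, -⟩ := (isNzmWord_append_singleton p v b).1 hw'
      rw [hv.value_append hp] at h
      simp only [value] at h
      omega
  | append_singleton w a ih =>
    obtain ⟨hu, h1, h2⟩ := (isNzmWord_append_singleton_iff_le_sonCount hp w a).1 hw
    rw [hu.value_append hp] at h
    rcases List.eq_nil_or_concat w' with rfl | ⟨v, b, rfl⟩
    · simp only [value] at h
      omega
    · rw [List.concat_eq_append] at *
      obtain ⟨hv, h1', h2'⟩ := (isNzmWord_append_singleton_iff_le_sonCount hp v b).1 hw'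
      rw [hv.value_append hp] at h
      obtain ⟨e1, rfl⟩ := sonsUpTo_add_inj hp h1 h2 h1' h2' h
      rw [ih hu hv e1]

theorem IsNzmCode.isNzmWord {p n : ℕ} {w : List ℕ} (h : IsNzmCode p w n) : IsNzmWord p w := by
  obtain rfl := h.value_eq
  exact h

theorem existsUnique_isNzmCode {p : ℕ} (hp : 5 ≤ p) (n : ℕ) : ∃! w, IsNzmCode p w n := by
  obtain ⟨w, hw⟩ := exists_isNzmCode hp n
  exact ⟨w, hw, fun v hv =>
    hv.isNzmWord.value_inj hp hw.isNzmWord (hv.value_eq.trans hw.value_eq.symm)⟩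

theorem nzmCode_spec {p : ℕ} (hp : 5 ≤ p) (n : ℕ) : IsNzmCode p (nzmCode p n) n :=
  Classical.epsilon_spec (exists_isNzmCode hp n)

theorem IsNzmWord.nzmCode_value {p : ℕ} (hp : 5 ≤ p) {w : List ℕ} (hw : IsNzmWord p w) :
    nzmCode p (value p w) = w :=
  (existsUnique_isNzmCode hp _).unique (nzmCode_spec hp _) hw

/-! ### Successors -/

theorem succ_eq {p : ℕ} (hp : 5 ≤ p) (n : ℕ) : succ p n = sonsUpTo p n + 1 := by
  have h := nzmCode_spec hp n
  rw [succ, h.isNzmWord.value_append hp, h.value_eq]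

theorem succ_strictMono {p : ℕ} (hp : 5 ≤ p) : StrictMono (succ p) := fun m n h => by
  rw [succ_eq hp, succ_eq hp]
  exact Nat.succ_lt_succ (sonsUpTo_strictMono hp h)

theorem nzmCode_succ {p : ℕ} (hp : 5 ≤ p) (n : ℕ) :
    nzmCode p (succ p n) = nzmCode p n ++ [1] := by
  apply IsNzmWord.nzmCode_value hp
  refine (isNzmWord_append_singleton_iff_le_sonCount hp _ _).2
    ⟨(nzmCode_spec hp n).isNzmWord, le_rfl, ?_⟩
  have := two_le_sonCount hp (value p (nzmCode p n))
  omega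

theorem phi_succ {p : ℕ} (hp : 5 ≤ p) (n : ℕ) : phi p (succ p n) = n := by
  rw [phi, nzmCode_succ hp, List.dropLast_concat, (nzmCode_spec hp n).value_eq]

theorem isOneNode_iff {p : ℕ} (hp : 5 ≤ p) (v : ℕ) : IsOneNode p v ↔ ∃ n, succ p n = v := by
  constructor
  · intro h
    obtain ⟨w, hw⟩ := List.getLast?_eq_some_iff.1 h
    have hc := nzmCode_spec hp v
    rw [hw] at hc
    have hw' := ((isNzmWord_append_singleton p w 1).1 hc.isNzmWord).1
    refine ⟨value p w, ?_⟩
    rw [succ, hw'.nzmCode_value hp, hc.value_eq]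
  · rintro ⟨n, rfl⟩
    simp [IsOneNode, nzmCode_succ hp]

theorem mem_oneTree_nodes {p : ℕ} (hp : 5 ≤ p) (v : ℕ) :
    v ∈ (oneTree p).nodes ↔ ∃ n, 1 ≤ n ∧ succ p n = v := by
  -- The excluded `1`-node is the successor of `0`, whose code is empty.
  have h0 : succ p 0 = 1 := by rw [succ_eq hp, sonsUpTo_zero]
  change 2 ≤ v ∧ IsOneNode p v ↔ _
  rw [isOneNode_iff hp]
  constructor
  · rintro ⟨h, n, rfl⟩
    refine ⟨n, Nat.one_le_iff_ne_zero.2 ?_, rfl⟩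
    rintro rfl
    omega
  · rintro ⟨n, hn, rfl⟩
    have := succ_strictMono hp (show 0 < n from hn)
    exact ⟨by omega, n, rfl⟩

/-! ### The levels of the white metallic tree -/

/-- The number of nodes on the levels `0, ..., k - 1` of the white metallic tree. -/
def nodesBelow (p : ℕ) : ℕ → ℕ
  | 0 => 0
  | k + 1 => sonsUpTo p (nodesBelow p k) + 1

theorem nodesBelow_lt_succ {p : ℕ} (hp : 5 ≤ p) (k : ℕ) :
    nodesBelow p k < nodesBelow p (k + 1) :=
  Nat.lt_succ_of_le ((sonsUpTo_strictMono hp).le_apply)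

theorem nodesBelow_strictMono {p : ℕ} (hp : 5 ≤ p) : StrictMono (nodesBelow p) :=
  strictMono_nat_of_lt_succ (nodesBelow_lt_succ hp)

theorem whiteTree_sons_succ (p n : ℕ) :
    (whiteTree p).sons (n + 1) = List.range' (sonsUpTo p n + 2) (sonCount p (n + 1)) := by
  rw [← rhoLeft_succ]
  rfl

theorem flatMap_whiteTree_sons {p : ℕ} (hp : 5 ≤ p) (n l : ℕ) :
    (List.range' (n + 1) l).flatMap (whiteTree p).sons =
      List.range' (sonsUpTo p n + 2) (sonsUpTo p (n + l) - sonsUpTo p n) := by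
  induction l with
  | zero => simp
  | succ l ih =>
    have hm := (sonsUpTo_strictMono hp).monotone (Nat.le_add_right n l)
    rw [List.range'_1_concat, List.flatMap_append, ih, List.flatMap_singleton,
      add_right_comm n 1 l, whiteTree_sons_succ,
      show sonsUpTo p (n + l) + 2 = sonsUpTo p n + 2 + (sonsUpTo p (n + l) - sonsUpTo p n) by omega,
      List.range'_append_1, ← add_assoc n l 1, sonsUpTo_succ p (n + l)]
    congr 1
    omega

theorem whiteTree_level {p : ℕ} (hp : 5 ≤ p) (k : ℕ) :
    (whiteTree p).level k =
      List.range' (nodesBelow p k + 1) (nodesBelow p (k + 1) - nodesBelow p k) := by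
  induction k with
  | zero => rfl
  | succ k ih =>
    have h := nodesBelow_lt_succ hp k
    rw [OrderedTree.level, ih, flatMap_whiteTree_sons hp, Nat.add_sub_cancel' h.le]
    simp only [nodesBelow, Nat.add_sub_add_right]

theorem sum_length_level {p : ℕ} (hp : 5 ≤ p) (k : ℕ) :
    ∑ j ∈ Finset.range k, ((whiteTree p).level j).length = nodesBelow p k := by
  induction k with
  | zero => rfl
  | succ k ih =>
    have h := nodesBelow_lt_succ hp k
    rw [Finset.sum_range_succ, ih, whiteTree_level hp, List.length_range']
    omega

theorem whiteTree_level_getElem? {p : ℕ} (hp : 5 ≤ p) (k i n : ℕ) :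
    ((whiteTree p).level k)[i]? = some n ↔
      n = nodesBelow p k + i + 1 ∧ n ≤ nodesBelow p (k + 1) := by
  have h := nodesBelow_lt_succ hp k
  rw [whiteTree_level hp, List.getElem?_eq_some_iff]
  simp only [List.length_range', List.getElem_range', one_mul, exists_prop]
  omega

theorem whiteTree_hasNumber {p : ℕ} (hp : 5 ≤ p) {k i n : ℕ}
    (h : ((whiteTree p).level k)[i]? = some n) (m : ℕ) :
    m = (∑ j ∈ Finset.range k, ((whiteTree p).level j).length) + i + 1 ↔ m = n := by
  rw [sum_length_level hp, ((whiteTree_level_getElem? hp k i n).1 h).1]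

theorem whiteTree_existsUnique_place {p : ℕ} (hp : 5 ≤ p) {n : ℕ} (hn : 1 ≤ n) :
    ∃! ki : ℕ × ℕ, ((whiteTree p).level ki.1)[ki.2]? = some n := by
  have hex : ∃ k, n ≤ nodesBelow p k := ⟨n, (nodesBelow_strictMono hp).le_apply⟩
  classical
  -- The level of `n` is the last `k` with `nodesBelow p k < n`.
  obtain ⟨k, hk⟩ : ∃ k, Nat.find hex = k + 1 :=
    Nat.exists_eq_succ_of_ne_zero fun h => by
      have := Nat.find_spec hex
      rw [h] at this
      exact absurd (hn.trans this) (by simp [nodesBelow])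
  have h1 : n ≤ nodesBelow p (k + 1) := hk ▸ Nat.find_spec hex
  have h2 : nodesBelow p k < n := not_le.1 (Nat.find_min hex (by omega))
  refine ⟨(k, n - nodesBelow p k - 1), (whiteTree_level_getElem? hp _ _ _).2
    ⟨by simp only; omega, h1⟩, ?_⟩
  rintro ⟨k', i'⟩ h
  obtain ⟨h3, h4⟩ := (whiteTree_level_getElem? hp _ _ _).1 h
  simp only at h3 h4
  have hm := (nodesBelow_strictMono hp).monotone
  obtain rfl : k' = k := by
    rcases lt_trichotomy k' k with hlt | h | hlt
    · have := hm (show k' + 1 ≤ k from hlt)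
      omega
    · exact h
    · have := hm (show k + 1 ≤ k' from hlt)
      omega
  ext
  · rfl
  · simp only
    omega

theorem whiteTree_isInfiniteTree {p : ℕ} (hp : 5 ≤ p) : (whiteTree p).IsInfiniteTree where
  level_subset k a ha := by
    obtain ⟨i, hi⟩ := List.mem_iff_getElem?.1 ha
    have := ((whiteTree_level_getElem? hp k i a).1 hi).1
    change 1 ≤ a
    omega
  existsUnique_place a ha := whiteTree_existsUnique_place hp ha
  level_ne_nil k := by
    have := nodesBelow_lt_succ hp k
    rw [whiteTree_level hp]
    simp only [ne_eq, List.range'_eq_nil_iff]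
    omega

theorem rho_isRightmostAssignment {p : ℕ} (hp : 5 ≤ p) :
    IsRightmostAssignment p (whiteTree p) (rho p) where
  isAssignment :=
    { status_root := rhoStatus_one p
      status_eq := fun a ha => by
        obtain ⟨n, rfl⟩ := Nat.exists_eq_add_of_le' ha
        exact Nat.le_one_iff_eq_zero_or_eq_one.1 (rhoStatus_le_one hp n)
      length_sons := fun a _ => List.length_range'
      head_sons := fun a ha => by
        obtain ⟨n, rfl⟩ := Nat.exists_eq_add_of_le' ha
        have := two_le_sonCount hp n
        rw [whiteTree_sons_succ, List.head?_range', if_neg (by omega), ← rhoLeft_succ]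
        rfl
      blackPos_mem := fun a ha => by
        obtain ⟨n, rfl⟩ := Nat.exists_eq_add_of_le' ha
        have := rhoStatus_le_one hp n
        change 1 ≤ p - 2 - rhoStatus p (n + 1) ∧ _ ≤ p - 2 - rhoStatus p (n + 1)
        exact ⟨by omega, le_rfl⟩
      status_sons := fun a ha i b hb => by
        obtain ⟨n, rfl⟩ := Nat.exists_eq_add_of_le' ha
        rw [whiteTree_sons_succ, List.getElem?_eq_some_iff] at hb
        obtain ⟨hi, rfl⟩ := hb
        rw [List.length_range'] at hi
        change rhoStatus p _ = 1 ↔ i + 1 = sonCount p (n + 1)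
        rw [List.getElem_range', one_mul, add_right_comm, rhoStatus_son hp hi]
        split_ifs <;> simp_all }
  blackPos_eq _ _ := rfl

/-! ### The tree of the `1`-nodes -/

open Classical in
-- The last son of `n` is `succ p n`; the other sons lie strictly between `succ p (n - 1)` and `succ
-- p n`, where monotonicity leaves no `1`-node.
theorem filter_isOneNode_sons {p : ℕ} (hp : 5 ≤ p) {n : ℕ} (hn : 1 ≤ n) :
    ((whiteTree p).sons n).filter (fun u => decide (IsOneNode p u)) = [succ p n] := by
  obtain ⟨n, rfl⟩ := Nat.exists_eq_add_of_le' hn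
  obtain ⟨c, hc⟩ : ∃ c, sonCount p (n + 1) = c + 1 :=
    ⟨sonCount p (n + 1) - 1, by have := two_le_sonCount hp n; omega⟩
  have hs : sonsUpTo p n + 2 + c = succ p (n + 1) := by
    rw [succ_eq hp, sonsUpTo_succ, hc]
    ring
  rw [whiteTree_sons_succ, hc, List.range'_1_concat, List.filter_append, hs,
    List.filter_eq_nil_iff.2, List.nil_append, List.filter_singleton,
    decide_eq_true ((isOneNode_iff hp _).2 ⟨_, rfl⟩), cond_true]
  intro a ha
  rw [List.mem_range'_1] at ha
  rw [decide_eq_true_iff, isOneNode_iff hp]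
  rintro ⟨m, rfl⟩
  have h1 : n < m := (succ_strictMono hp).lt_iff_lt.1 (by rw [succ_eq hp n]; omega)
  have h2 : m < n + 1 := (succ_strictMono hp).lt_iff_lt.1 (by omega)
  omega

open Classical in
theorem oneTree_sons_succ {p : ℕ} (hp : 5 ≤ p) {n : ℕ} (hn : 1 ≤ n) :
    (oneTree p).sons (succ p n) = ((whiteTree p).sons n).map (succ p) := by
  have h (u : ℕ) (hu : u ∈ (whiteTree p).sons n) : 1 ≤ u := by
    obtain ⟨n, rfl⟩ := Nat.exists_eq_add_of_le' hn
    rw [whiteTree_sons_succ, List.mem_range'_1] at hu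
    omega
  simp only [oneTree, phi_succ hp]
  generalize (whiteTree p).sons n = l at h ⊢
  induction l with
  | nil => rfl
  | cons u l ih =>
    rw [List.flatMap_cons, List.filter_append, filter_isOneNode_sons hp (h u (by simp)),
      ih fun v hv => h v (by simp [hv])]
    rfl

/-- Since `succ` commutes with taking sons, it maps levels to levels in order; places and numbers
follow. -/
theorem oneTree_level {p : ℕ} (hp : 5 ≤ p) (k : ℕ) :
    (oneTree p).level k = ((whiteTree p).level k).map (succ p) := by
  induction k with
  | zero => rfl
  | succ k ih =>
    rw [OrderedTree.level, ih, OrderedTree.level, List.flatMap_map, List.map_flatMap]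
    exact List.flatMap_congr fun n hn =>
      oneTree_sons_succ hp ((whiteTree_isInfiniteTree hp).level_subset k n hn)

theorem oneTree_level_getElem? {p : ℕ} (hp : 5 ≤ p) (k i n : ℕ) :
    ((oneTree p).level k)[i]? = some (succ p n) ↔ ((whiteTree p).level k)[i]? = some n := by
  rw [oneTree_level hp, List.getElem?_map, Option.map_eq_some_iff]
  simp [(succ_strictMono hp).injective.eq_iff]

theorem oneTree_hasNumber_succ {p : ℕ} (hp : 5 ≤ p) (n m : ℕ) :
    (oneTree p).HasNumber (succ p n) m ↔ (whiteTree p).HasNumber n m := by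
  simp only [OrderedTree.HasNumber, oneTree_level_getElem? hp]
  simp only [oneTree_level hp, List.length_map]

theorem whiteTree_hasNumber_self {p : ℕ} (hp : 5 ≤ p) {n : ℕ} (hn : 1 ≤ n) :
    (whiteTree p).HasNumber n n := by
  obtain ⟨⟨k, i⟩, h, -⟩ := whiteTree_existsUnique_place hp hn
  exact ⟨k, i, h, (whiteTree_hasNumber hp h n).2 rfl⟩

theorem oneTree_isInfiniteTree {p : ℕ} (hp : 5 ≤ p) : (oneTree p).IsInfiniteTree where
  level_subset k a ha := by
    rw [oneTree_level hp, List.mem_map] at ha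
    obtain ⟨n, hn, rfl⟩ := ha
    exact (mem_oneTree_nodes hp _).2 ⟨n, (whiteTree_isInfiniteTree hp).level_subset k n hn, rfl⟩
  existsUnique_place a ha := by
    obtain ⟨n, hn, rfl⟩ := (mem_oneTree_nodes hp a).1 ha
    simp only [oneTree_level_getElem? hp]
    exact whiteTree_existsUnique_place hp hn
  level_ne_nil k := by
    rw [oneTree_level hp, ne_eq, List.map_eq_nil_iff]
    exact (whiteTree_isInfiniteTree hp).level_ne_nil k

theorem phi_bijOn {p : ℕ} (hp : 5 ≤ p) :
    Set.BijOn (phi p) (oneTree p).nodes (whiteTree p).nodes := by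
  refine ⟨fun v hv => ?_, fun v hv v' hv' h => ?_, fun n hn =>
    ⟨succ p n, (mem_oneTree_nodes hp _).2 ⟨n, hn, rfl⟩, phi_succ hp n⟩⟩
  · obtain ⟨n, hn, rfl⟩ := (mem_oneTree_nodes hp v).1 hv
    rw [phi_succ hp]
    exact hn
  · obtain ⟨n, -, rfl⟩ := (mem_oneTree_nodes hp v).1 hv
    obtain ⟨m, -, rfl⟩ := (mem_oneTree_nodes hp v').1 hv'
    rw [phi_succ hp, phi_succ hp] at h
    rw [h]

theorem phi_isNumberedIso {p : ℕ} (hp : 5 ≤ p) :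
    (oneTree p).IsNumberedIso (whiteTree p) (phi p) where
  source := oneTree_isInfiniteTree hp
  target := whiteTree_isInfiniteTree hp
  bijOn := phi_bijOn hp
  number_iff a ha m := by
    obtain ⟨n, -, rfl⟩ := (mem_oneTree_nodes hp a).1 ha
    rw [phi_succ hp, oneTree_hasNumber_succ hp]
  level_iff a ha k := by
    obtain ⟨n, -, rfl⟩ := (mem_oneTree_nodes hp a).1 ha
    simp only [phi_succ hp, List.mem_iff_getElem?, oneTree_level_getElem? hp]
  length_sons a ha := by
    obtain ⟨n, hn, rfl⟩ := (mem_oneTree_nodes hp a).1 ha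
    rw [phi_succ hp, oneTree_sons_succ hp hn, List.length_map]
  map_root := phi_succ hp 1
  map_sons a ha := by
    obtain ⟨n, hn, rfl⟩ := (mem_oneTree_nodes hp a).1 ha
    rw [phi_succ hp, oneTree_sons_succ hp hn, List.map_map,
      show phi p ∘ succ p = id from funext (phi_succ hp), List.map_id]

/-- Injectivity of `phi` on the nodes forces the chosen inverse to be `succ`. -/
theorem invFunOn_phi {p : ℕ} (hp : 5 ≤ p) {n : ℕ} (hn : 1 ≤ n) :
    Function.invFunOn (phi p) (oneTree p).nodes n = succ p n := by
  have h := (phi_bijOn hp).injOn.leftInvOn_invFunOn ((mem_oneTree_nodes hp _).2 ⟨n, hn, rfl⟩)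
  rwa [phi_succ hp] at h

theorem transport_isRightmostAssignment {p : ℕ} (hp : 5 ≤ p) :
    IsRightmostAssignment p (oneTree p) ((rho p).transport (phi p) (oneTree p).nodes) := by
  obtain ⟨⟨h1, h2, h3, h4, h5, h6⟩, h7⟩ := rho_isRightmostAssignment hp
  have hs (n : ℕ) :
      ((rho p).transport (phi p) (oneTree p).nodes).status (succ p n) = (rho p).status n :=
    congrArg (rho p).status (phi_succ hp n)
  have hb (n : ℕ) :
      ((rho p).transport (phi p) (oneTree p).nodes).blackPos (succ p n) = (rho p).blackPos n :=
    congrArg (rho p).blackPos (phi_succ hp n)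
  refine ⟨⟨(hs 1).trans h1, ?_, ?_, ?_, ?_, ?_⟩, ?_⟩ <;> intro a ha <;>
    obtain ⟨n, hn, rfl⟩ := (mem_oneTree_nodes hp a).1 ha
  · rw [hs]
    exact h2 n hn
  · rw [hs, oneTree_sons_succ hp hn, List.length_map]
    exact h3 n hn
  · have hl : 1 ≤ (rho p).leftmost n := by
      change 1 ≤ 2 + _
      omega
    rw [oneTree_sons_succ hp hn, List.head?_map, h4 n hn, Option.map_some, ← invFunOn_phi hp hl]
    simp only [Assignment.transport, phi_succ hp]
  · rw [hs, hb]
    exact h5 n hn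
  · intro i b hbi
    rw [oneTree_sons_succ hp hn, List.getElem?_map, Option.map_eq_some_iff] at hbi
    obtain ⟨u, hu, rfl⟩ := hbi
    rw [hs, hb]
    exact h6 n hn i u hu
  · rw [hs, hb]
    exact h7 n hn

end Metallic

theorem mainTheorem9 (p : ℕ) (hp : 5 ≤ p) :
    -- the codes, the tree and the rightmost assignment are as they should be
    (∀ n, 1 ≤ n → ∃! w, Metallic.IsNzmCode p w n) ∧
    Metallic.IsRightmostAssignment p (Metallic.whiteTree p) (Metallic.rho p) ∧
    -- the mapping sends the node with code `[n]1` to `n`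
    (∀ n, 1 ≤ n → Metallic.succ p n ∈ (Metallic.oneTree p).nodes ∧
      Metallic.nzmCode p (Metallic.succ p n) = Metallic.nzmCode p n ++ [1] ∧
      Metallic.phi p (Metallic.succ p n) = n) ∧
    -- it is an isomorphism of numbered trees; the number of `v` among the `1`-nodes is its image
    (Metallic.oneTree p).IsNumberedIso (Metallic.whiteTree p) (Metallic.phi p) ∧
    (∀ v ∈ (Metallic.oneTree p).nodes, (Metallic.oneTree p).HasNumber v (Metallic.phi p v)) ∧
    -- its inverse transports the rightmost assignment
    Metallic.IsRightmostAssignment p (Metallic.oneTree p)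
      ((Metallic.rho p).transport (Metallic.phi p) (Metallic.oneTree p).nodes) := by
  refine ⟨fun n _ => Metallic.existsUnique_isNzmCode hp n, Metallic.rho_isRightmostAssignment hp,
    fun n hn => ⟨(Metallic.mem_oneTree_nodes hp _).2 ⟨n, hn, rfl⟩, Metallic.nzmCode_succ hp n,
      Metallic.phi_succ hp n⟩, Metallic.phi_isNumberedIso hp, fun v hv => ?_,
    Metallic.transport_isRightmostAssignment hp⟩
  obtain ⟨n, hn, rfl⟩ := (Metallic.mem_oneTree_nodes hp v).1 hv
  rw [Metallic.phi_succ hp, Metallic.oneTree_hasNumber_succ hp]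
  exact Metallic.whiteTree_hasNumber_self hp hn
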